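/- Let $R$ be an associative ring with $1$; modules are unitary left $R$-modules. Let $\mathcal A$ be a set of finitely presented modules, let $\mathcal B=\operatorname{add}\mathcal A$ be the class of all direct summands of finite direct sums of modules from $\mathcal A$, and let $\mathcal C=\varinjlim\mathcal B$ be the class of all direct limits of modules from $\mathcal B$. Put $F_{\mathcal A}=\bigoplus_{A\in\mathcal A}A^{(\omega)}$ and let $T_{\mathcal A}$ be the complete first-order theory of $F_{\mathcal A}$ in the language of $R$-modules (with $0$, $+$ and a unary function symbol for each scalar). A $\mathcal C$-model is a model of $T_{\mathcal A}$ that belongs to $\mathcal C$. An $n$-ary pp formula is a formula $\exists \bar y\,(A\bar y = B\bar x)$ with matrices $A,B$ over $R$ and $\bar x=(x_1,\dots,x_n)$. Write $\phi\le\psi$ if $\phi$ implies $\psi$ in every module. The pp type of a tuple $\bar a$ in a module $M$ is the set of all pp formulas that $\bar a$ satisfies in $M$. A formula $\phi$ generates it if $\phi$ belongs to it and $\phi\le\psi$ for every $\psi$ in it, and the pp type is finitely generated if such a $\phi$ exists. Let $\Gamma_{\mathcal B}$ be the set of all pp formulas that generate the pp type of some tuple in some module from $\mathcal B$. A pointed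 module $(M,\bar a)$ is a free realization of $\phi$ if $\bar a$ satisfies $\phi$ in $M$ and, for every module $N$ and every $\bar b$ satisfying $\phi$ in $N$, there is a homomorphism $M\to N$ taking $\bar a$ to $\bar b$. A module is Mittag-Leffler if every finite tuple in it has a finitely generated pp type, and pure-projective if it is a direct summand of a direct sum of finitely presented modules. Let $\Phi$ be a descending chain $\phi_0\ge\phi_1\ge\phi_2\ge\cdots$ of pp formulas of the same arity from $\Gamma_{\mathcal B}$. A Bass module $B_\Phi$ is the direct limit of a chain $A_0\xrightarrow{g_0}A_1\xrightarrow{g_1}A_2\to\cdots$, where $A_k\in\mathcal B$, $(A_k,\bar a_k)$ is a free realization of $\phi_k$, and $g_k(\bar a_k)=\bar a_{k+1}$, for all $k$. Then such choices of $(A_k,\bar a_k)$ and $g_k$ exist, and for every Bass module $B_\Phi$ so obtained the following hold. (1) $F_{\mathcal A}\oplus B_\Phi$ is a model of $T_{\mathcal A}$. (2) If $\Phi$ does not stabilize (that is, there is no $k$ such that $\phi_m$ is equivalent to $\phi_k$ in all modules for all $m\ge k$), then $F_{\mathcal A}\oplus B_\Phi$ is a $\mathcal C$-model that is not Mittag-Leffler,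 hence not pure-projective either. -/

import Mathlib

open scoped FirstOrder DirectSum

universe u

/-! ### Positive primitive formulas -/

/-- An `n`-ary pp formula `∃ y, A y = B x` over `R`, where `A` is an `m × l` matrix and
`B` is an `m × n` matrix. -/
structure PPFormula (R : Type u) (n : ℕ) where
  m : ℕ
  l : ℕ
  A : Matrix (Fin m) (Fin l) R
  B : Matrix (Fin m) (Fin n) R

namespace PPFormula

variable {R : Type u} [Ring R] {n : ℕ}

/-- The tuple `x` satisfies the pp formula `φ` in the module `M`. -/
def Realize (φ : PPFormula R n) {M : Type u} [AddCommGroup M] [Module R M] (x : Fin n → M) :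
    Prop :=
  ∃ y : Fin φ.l → M, ∀ i : Fin φ.m, ∑ j, φ.A i j • y j = ∑ k, φ.B i k • x k

/-- `φ ≤ ψ` means that `φ` implies `ψ` in every left `R`-module. -/
instance : Preorder (PPFormula R n) where
  le φ ψ := ∀ (M : Type u) [AddCommGroup M] [Module R M] (x : Fin n → M),
    φ.Realize x → ψ.Realize x
  le_refl _ := fun _ _ _ _ h => h
  le_trans _ _ _ h₁ h₂ := fun M _ _ x h => h₂ M x (h₁ M x h)

/-- A descending chain stabilizes (uniformly in the class of all modules) if from some point on
all its members are equivalent. -/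
def Stabilizes (Φ : ℕ → PPFormula R n) : Prop :=
  ∃ k, ∀ m, k ≤ m → Φ k ≤ Φ m ∧ Φ m ≤ Φ k

/-- The pp type of the tuple `a` in the module `M`. -/
def ppType {M : Type u} [AddCommGroup M] [Module R M] (a : Fin n → M) : Set (PPFormula R n) :=
  {φ | φ.Realize a}

/-- `φ` generates the pp type of the tuple `a` in `M`. -/
def Generates (φ : PPFormula R n) {M : Type u} [AddCommGroup M] [Module R M] (a : Fin n → M) :
    Prop :=
  φ ∈ ppType (R := R) a ∧ ∀ ψ ∈ ppType (R := R) a, φ ≤ ψ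

/-- `(M, a)` is a free realization of `φ`. -/
def IsFreeRealization (φ : PPFormula R n) {M : Type u} [AddCommGroup M] [Module R M]
    (a : Fin n → M) : Prop :=
  φ.Realize a ∧ ∀ (N : Type u) [AddCommGroup N] [Module R N] (b : Fin n → N),
    φ.Realize b → ∃ h : M →ₗ[R] N, ∀ i, h (a i) = b i

/-- The `n`-ary pp formulas that generate the pp type of some tuple in some module from the
class `G`. -/
def Gamma (G : ModuleCat.{u} R → Prop) (n : ℕ) : Set (PPFormula R n) :=
  {φ | ∃ (M : ModuleCat.{u} R) (a : Fin n → M), G M ∧ φ.Generates a}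

end PPFormula

/-! ### Classes of modules -/

section Classes

variable (R : Type u) [Ring R]

/-- `M` is (isomorphic to) a direct summand of `N`. -/
def IsDirectSummand (M N : Type u) [AddCommGroup M] [Module R M] [AddCommGroup N] [Module R N] :
    Prop :=
  ∃ (i : M →ₗ[R] N) (p : N →ₗ[R] M), p ∘ₗ i = LinearMap.id

/-- A module is Mittag-Leffler if the pp type of each of its (finite) tuples is finitely
generated. -/
def IsMittagLefflerModule (M : Type u) [AddCommGroup M] [Module R M] : Prop :=
  ∀ (n : ℕ) (a : Fin n → M), ∃ φ : PPFormula R n, φ.Generates a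

/-- A module is pure-projective if it is a direct summand of a direct sum of finitely presented
modules. -/
def IsPureProjective (M : Type u) [AddCommGroup M] [Module R M] : Prop :=
  ∃ (J : Type u) (X : J → ModuleCat.{u} R), (∀ j, Module.FinitePresentation R (X j)) ∧
    IsDirectSummand R M (⨁ j, X j)

/-- `add A`: the direct summands of finite direct sums of modules from the family `A`
(repetitions are allowed in these sums). -/
def addClosure {ι : Type u} (A : ι → Type u) [∀ i, AddCommGroup (A i)] [∀ i, Module R (A i)]
    (M : ModuleCat.{u} R) : Prop :=
  ∃ (k : ℕ) (s : Fin k → ι), IsDirectSummand R M (⨁ j, A (s j))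

/-- `lim B`: the direct limits of directed systems of modules from the class `B`. -/
def limClosure (B : ModuleCat.{u} R → Prop) (M : ModuleCat.{u} R) : Prop :=
  ∃ (J : Type u) (_ : Preorder J) (_ : Nonempty J) (_ : IsDirectedOrder J) (_ : DecidableEq J)
    (G : J → ModuleCat.{u} R) (f : ∀ i j, i ≤ j → G i →ₗ[R] G j)
    (_ : DirectedSystem (fun j => G j) (fun i j h => f i j h)),
    (∀ j, B (G j)) ∧ Nonempty (M ≃ₗ[R] Module.DirectLimit (fun j => G j) f)

/-- `F_A`: the direct sum of countably infinitely many copies of each member of the family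
`A`. -/
abbrev PureFree {ι : Type u} (A : ι → Type u) [∀ i, AddCommGroup (A i)] : Type u :=
  ⨁ i, (ℕ →₀ A i)

end Classes

/-! ### The first-order language of `R`-modules -/

/-- The function symbols: a constant `0`, a binary `+`, and a unary symbol for each scalar. -/
inductive ModuleFunctions (R : Type u) : ℕ → Type u
  | zero : ModuleFunctions R 0
  | smul (r : R) : ModuleFunctions R 1
  | add : ModuleFunctions R 2

/-- The first-order language of left `R`-modules; it has no relation symbols but equality. -/
def moduleLanguage (R : Type u) : FirstOrder.Language.{u, 0} where
  Functions := ModuleFunctions R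
  Relations := fun _ => Empty

/-- Every module is a structure for the language of modules, with the obvious interpretation. -/
instance moduleStructure (R : Type u) [Ring R] (M : Type u) [AddCommGroup M] [Module R M] :
    (moduleLanguage R).Structure M where
  funMap := fun {_} f => match f with
    | ModuleFunctions.zero => fun _ => 0
    | ModuleFunctions.smul r => fun x => r • x 0
    | ModuleFunctions.add => fun x => x 0 + x 1
  RelMap := fun r => Empty.elim r

/-- `T_A`: the complete theory of `F_A` in the language of modules. -/
def pureFreeTheory (R : Type u) [Ring R] {ι : Type u} (A : ι → Type u) [∀ i, AddCommGroup (A i)]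
    [∀ i, Module R (A i)] : (moduleLanguage R).Theory :=
  (moduleLanguage R).completeTheory (PureFree A)

/-- A `C`-model: a model of `T_A` that belongs to `C = lim (add A)`. -/
def IsCModel (R : Type u) [Ring R] {ι : Type u} (A : ι → Type u) [∀ i, AddCommGroup (A i)]
    [∀ i, Module R (A i)] (M : Type u) [AddCommGroup M] [Module R M] : Prop :=
  M ⊨ pureFreeTheory R A ∧ limClosure R (addClosure R A) (ModuleCat.of R M)

/-! ### Generalized Bass modules -/

/-- The choices made in the construction of a Bass module for a chain `Φ` of pp formulas: free
realizations `(obj k, pt k)` of `Φ k` with `obj k` in the class `B`, and maps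
`(obj k, pt k) → (obj (k + 1), pt (k + 1))` of pointed modules. -/
structure BassSystem {R : Type u} [Ring R] (B : ModuleCat.{u} R → Prop) {n : ℕ}
    (Φ : ℕ → PPFormula R n) where
  obj : ℕ → ModuleCat.{u} R
  pt : ∀ k, Fin n → obj k
  mem : ∀ k, B (obj k)
  free : ∀ k, (Φ k).IsFreeRealization (pt k)
  map : ∀ k, obj k →ₗ[R] obj (k + 1)
  map_pt : ∀ k i, map k (pt k i) = pt (k + 1) i

namespace BassSystem

variable {R : Type u} [Ring R] {B : ModuleCat.{u} R → Prop} {n : ℕ} {Φ : ℕ → PPFormula R n}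

/-- The composite of the maps `map i`, …, `map (j - 1)`. -/
def trans (S : BassSystem B Φ) (i j : ℕ) (h : i ≤ j) : S.obj i →ₗ[R] S.obj j :=
  Nat.leRec (motive := fun k _ => S.obj i →ₗ[R] S.obj k) LinearMap.id
    (fun k _ t => S.map k ∘ₗ t) h

theorem trans_self (S : BassSystem B Φ) (i : ℕ) : S.trans i i le_rfl = LinearMap.id :=
  Nat.leRec_self _ _

theorem trans_succ (S : BassSystem B Φ) (i j : ℕ) (h : i ≤ j) :
    S.trans i (j + 1) (h.trans (Nat.le_succ j)) = S.map j ∘ₗ S.trans i j h :=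
  Nat.leRec_succ _ _ h

instance (S : BassSystem B Φ) :
    DirectedSystem (fun k => S.obj k) (fun i j h => S.trans i j h) where
  map_self _ _ := by rw [trans_self]; rfl
  map_map k j i hij hjk x := by
    induction hjk with
    | refl => exact LinearMap.congr_fun (S.trans_self j) _
    | step hjk ih =>
      rw [S.trans_succ _ _ hjk, S.trans_succ _ _ (hij.trans hjk), LinearMap.comp_apply,
        LinearMap.comp_apply, ih]

/-- The Bass module: the direct limit of the chain `obj 0 → obj 1 → obj 2 → ⋯`. -/
abbrev bassModule (S : BassSystem B Φ) : Type u :=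
  Module.DirectLimit (fun k => S.obj k) S.trans

end BassSystem

/-!
Everything rests on two facts about pp formulas: they are preserved by homomorphisms, and a pp
formula that holds of a tuple in a direct limit already holds of it at a finite stage
(`PPFormula.exists_realize_of_directLimit`).

For a pp formula `φ` in `n + 1` variables, the solutions `y` of `φ(x, y)` form the empty set or a
coset of the subgroup `PPFormula.fiber` of the solutions of `φ(0, y)`. In `F_A` every index of
such subgroups is `1` or infinite, since each member of `A` occurs infinitely often: the index of
`ψ ∧ φ` in `φ` is `1` if the fiber of `φ` lies in that of `ψ` in every member of `A`, and infinite
otherwise. Inclusions of fibers pass to direct sums, direct summands and direct limits, so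
`F_A ⊕ B_Φ` has the same indices.

When all indices are `1` or infinite, B. H. Neumann's lemma on coverings by cosets shows that the
solutions of `φ(x, y)` are covered by those of `ψ₁(x, y), …, ψₖ(x, y)` only for the reason that
some `ψᵢ(x, y)` is solvable together with `φ(x, y)` and its fiber contains that of `φ`
(`PPFormula.IndicesGovernedBy.exists_of_cover`). An existential quantifier over a Boolean
combination of pp formulas can therefore be eliminated, uniformly in all modules with the given
indices (`PPFormula.exists_pp_normalForm`). A pp formula without free variables is true in every
module, so modules with the same indices satisfy the same sentences. Thus `F_A ⊕ B_Φ` is a model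
of `T_A`.

A tuple in a finitely presented module is a free realization of any generator of its pp type,
because the pp type contains the formula expressing the defining relations. This provides the
free realizations, and the maps between them, that a Bass module is built from. The pp type of the
distinguished tuple in the limit consists of the formulas above some member of `Φ`. A generator of
it would lie between some `Φ k` and all the `Φ m`, and `Φ` would stabilize. A pure-projective
module, on the other hand, is Mittag-Leffler: a tuple in a direct sum of finitely presented modules
lies in a finite subsum, where its pp type is finitely generated.
-/

/-! ### Closure properties of pp formulas -/

namespace PPFormula

section Construct

variable {R : Type u} [Ring R] {n : ℕ}

/-- The pp formula `∃ y, A y = B x` for coefficients indexed by arbitrary finite types. -/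
noncomputable def ofSystem {I L : Type} [Fintype I] [Fintype L] (A : I → L → R)
    (B : I → Fin n → R) : PPFormula R n where
  m := Fintype.card I
  l := Fintype.card L
  A := Matrix.of fun i j => A ((Fintype.equivFin I).symm i) ((Fintype.equivFin L).symm j)
  B := Matrix.of fun i => B ((Fintype.equivFin I).symm i)

theorem realize_ofSystem {I L : Type} [Fintype I] [Fintype L] (A : I → L → R)
    (B : I → Fin n → R) {M : Type u} [AddCommGroup M] [Module R M] (x : Fin n → M) :
    (ofSystem A B).Realize x ↔
      ∃ y : L → M, ∀ i, ∑ j, A i j • y j = ∑ k, B i k • x k := by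
  constructor
  · rintro ⟨y, hy⟩
    refine ⟨fun j => y (Fintype.equivFin L j), fun i => ?_⟩
    have h := hy (Fintype.equivFin I i)
    simp only [ofSystem, Matrix.of_apply, Equiv.symm_apply_apply] at h
    rw [← h]
    exact Fintype.sum_equiv (Fintype.equivFin L) _ _ (fun j => by simp)
  · rintro ⟨y, hy⟩
    exact ⟨fun j => y ((Fintype.equivFin L).symm j), fun i =>
      (Fintype.sum_equiv (Fintype.equivFin L).symm _ _ fun _ => rfl).trans
        (hy ((Fintype.equivFin I).symm i))⟩

/-- The conjunction of a finite family of pp formulas. -/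
noncomputable def conj {I : Type} [Fintype I] [DecidableEq I] (φ : I → PPFormula R n) :
    PPFormula R n :=
  ofSystem (I := Σ i, Fin (φ i).m) (L := Σ i, Fin (φ i).l)
    (fun e v => Matrix.blockDiagonal' (fun i => (φ i).A) e v) (fun e k => (φ e.1).B e.2 k)

theorem realize_conj {I : Type} [Fintype I] [DecidableEq I] (φ : I → PPFormula R n)
    {M : Type u} [AddCommGroup M] [Module R M] (x : Fin n → M) :
    (conj φ).Realize x ↔ ∀ i, (φ i).Realize x := by
  have key : ∀ (y : (Σ i, Fin (φ i).l) → M) (i : I) (e : Fin (φ i).m),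
      ∑ j, Matrix.blockDiagonal' (fun i => (φ i).A) ⟨i, e⟩ j • y j =
        ∑ v, (φ i).A e v • y ⟨i, v⟩ := by
    intro y i e
    rw [Fintype.sum_sigma, Finset.sum_eq_single i]
    · simp
    · intro j _ hj
      refine Finset.sum_eq_zero fun v _ => ?_
      rw [Matrix.blockDiagonal'_apply_ne _ _ _ hj.symm, zero_smul]
    · simp
  rw [conj, realize_ofSystem]
  constructor
  · rintro ⟨y, hy⟩ i
    exact ⟨fun v => y ⟨i, v⟩, fun e => (key y i e).symm.trans (hy ⟨i, e⟩)⟩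
  · intro h
    choose y hy using h
    exact ⟨fun v => y v.1 v.2, fun e => (key _ e.1 e.2).trans (hy e.1 e.2)⟩

/-- Existential quantification of a pp formula over its last variable. -/
noncomputable def exLast (φ : PPFormula R (n + 1)) : PPFormula R n :=
  ofSystem (I := Fin φ.m) (L := Fin φ.l ⊕ Unit)
    (fun i => Sum.elim (φ.A i) fun _ => -φ.B i (Fin.last n)) (fun i k => φ.B i k.castSucc)

theorem realize_exLast (φ : PPFormula R (n + 1)) {M : Type u} [AddCommGroup M] [Module R M]
    (x : Fin n → M) :
    φ.exLast.Realize x ↔ ∃ z : M, φ.Realize (Fin.snoc (α := fun _ => M) x z) := by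
  rw [exLast, realize_ofSystem]
  simp only [Fintype.sum_sum_type, Sum.elim_inl, Sum.elim_inr, Finset.univ_unique,
    Finset.sum_singleton, Realize, Fin.sum_univ_castSucc, Fin.snoc_castSucc, Fin.snoc_last,
    neg_smul]
  constructor
  · rintro ⟨y, hy⟩
    exact ⟨y (Sum.inr ()), fun v => y (Sum.inl v), fun i => by rw [← hy i]; abel⟩
  · rintro ⟨z, y, hy⟩
    exact ⟨Sum.elim y fun _ => z, fun i => by simp [hy i]⟩

/-- The pp formula `∑ k, c k • x k = 0`. -/
noncomputable def linear (c : Fin n → R) : PPFormula R n :=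
  ofSystem (I := Unit) (L := Empty) (fun _ _ => 0) (fun _ => c)

theorem realize_linear (c : Fin n → R) {M : Type u} [AddCommGroup M] [Module R M]
    (x : Fin n → M) : (linear c).Realize x ↔ ∑ k, c k • x k = 0 := by
  rw [linear, realize_ofSystem]
  simp [eq_comm]

end Construct

/-! ### Realization of pp formulas under module constructions -/

section Realize

variable {R : Type u} [Ring R] {n : ℕ} {M N : Type u} [AddCommGroup M] [Module R M]
  [AddCommGroup N] [Module R N]

theorem Realize.map {φ : PPFormula R n} {x : Fin n → M} (h : φ.Realize x) (f : M →ₗ[R] N) :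
    φ.Realize (f ∘ x) := by
  obtain ⟨y, hy⟩ := h
  exact ⟨f ∘ y, fun i => by simpa [map_sum] using congrArg f (hy i)⟩

theorem realize_zero (φ : PPFormula R n) : φ.Realize (0 : Fin n → M) :=
  ⟨0, by simp⟩

theorem Realize.add {φ : PPFormula R n} {x y : Fin n → M} (hx : φ.Realize x)
    (hy : φ.Realize y) : φ.Realize (x + y) := by
  obtain ⟨u, hu⟩ := hx
  obtain ⟨v, hv⟩ := hy
  exact ⟨u + v, fun i => by simp [smul_add, Finset.sum_add_distrib, hu, hv]⟩

theorem Realize.neg {φ : PPFormula R n} {x : Fin n → M} (hx : φ.Realize x) :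
    φ.Realize (-x) := by
  obtain ⟨u, hu⟩ := hx
  exact ⟨-u, fun i => by simp [hu]⟩

theorem Realize.sub {φ : PPFormula R n} {x y : Fin n → M} (hx : φ.Realize x)
    (hy : φ.Realize y) : φ.Realize (x - y) :=
  sub_eq_add_neg x y ▸ hx.add hy.neg

/-- A solution of a pp formula in a direct limit comes from a solution at a finite stage. -/
theorem exists_realize_of_directLimit {J : Type} [Preorder J] [Nonempty J]
    [IsDirectedOrder J] [DecidableEq J] {G : J → Type u} [∀ j, AddCommGroup (G j)]
    [∀ j, Module R (G j)] {f : ∀ i j, i ≤ j → G i →ₗ[R] G j}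
    [DirectedSystem G fun i j h => f i j h] {φ : PPFormula R n} {j : J} {x : Fin n → G j}
    (h : φ.Realize (Module.DirectLimit.of R J G f j ∘ x)) :
    ∃ (k : J) (hjk : j ≤ k), φ.Realize (f j k hjk ∘ x) := by
  obtain ⟨y, hy⟩ := h
  -- The witnesses `y` all come from one stage `k₀ ≥ j`.
  choose s z hz using fun v => Module.DirectLimit.exists_of (y v)
  obtain ⟨k₀, hk₀⟩ := (Set.finite_range (Option.elim · j s)).bddAbove
  have hj : j ≤ k₀ := hk₀ ⟨none, rfl⟩
  have hs : ∀ v, s v ≤ k₀ := fun v => hk₀ ⟨some v, rfl⟩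
  -- Each equation holds in the limit, hence at some stage `t i ≥ k₀`.
  have hlim : ∀ i, ∃ (k : J) (hk : k₀ ≤ k), f k₀ k hk (∑ v, φ.A i v • f _ k₀ (hs v) (z v) -
      ∑ l, φ.B i l • f j k₀ hj (x l)) = 0 := by
    intro i
    refine Module.DirectLimit.of.zero_exact ?_
    simp only [map_sub, map_sum, map_smul, Module.DirectLimit.of_f, hz]
    exact sub_eq_zero.2 (hy i)
  choose t ht ht0 using hlim
  obtain ⟨k, hk⟩ := (Set.finite_range (Option.elim · k₀ t)).bddAbove
  have hk₀k : k₀ ≤ k := hk ⟨none, rfl⟩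
  refine ⟨k, hj.trans hk₀k, fun v => f _ k ((hs v).trans hk₀k) (z v), fun i => ?_⟩
  have h0 := congrArg (f (t i) k (hk ⟨some i, rfl⟩)) (ht0 i)
  rw [map_zero, DirectedSystem.map_map' f] at h0
  simp only [map_sub, map_sum, map_smul, DirectedSystem.map_map' f] at h0
  exact sub_eq_zero.1 h0

end Realize

/-! ### Free realizations -/

section Free

variable {R : Type u} [Ring R] {n : ℕ} {M N : Type u} [AddCommGroup M] [Module R M]
  [AddCommGroup N] [Module R N]

theorem IsFreeRealization.generates {φ : PPFormula R n} {a : Fin n → M}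
    (h : φ.IsFreeRealization a) : φ.Generates a := by
  refine ⟨h.1, fun ψ hψ N _ _ b hb => ?_⟩
  obtain ⟨f, hf⟩ := h.2 N b hb
  rw [← funext hf]
  exact hψ.map f

/-- A tuple in a finitely presented module is a free realization of the formula saying that it
is given by the same linear combinations of elements satisfying the defining relations. -/
theorem exists_isFreeRealization [Module.FinitePresentation R M] (a : Fin n → M) :
    ∃ φ : PPFormula R n, φ.IsFreeRealization a := by
  obtain ⟨m, K, e, t, rfl⟩ := Module.FinitePresentation.exists_fin R M
  choose c hc using fun i => Submodule.mkQ_surjective _ (e (a i))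
  let π : (Fin m → R) →ₗ[R] M := e.symm.toLinearMap ∘ₗ Submodule.mkQ _
  have hπ : ∀ i, π (c i) = a i := fun i => by
    simp only [π, LinearMap.comp_apply, hc]
    exact e.symm_apply_apply _
  have hπt : ∀ r ∈ t, π r = 0 := fun r hr => by
    simp only [π, LinearMap.comp_apply, Submodule.mkQ_apply]
    rw [(Submodule.Quotient.mk_eq_zero _).2 (Submodule.subset_span hr)]
    exact map_zero _
  have hπsum : ∀ r : Fin m → R, π r = ∑ j, r j • π (Pi.single j 1) := fun r => by
    conv_lhs => rw [pi_eq_sum_univ' r, map_sum]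
    simp only [map_smul]
  obtain ⟨t', ht'⟩ : ∃ t' : Fin t.card → (Fin m → R), Set.range t' = t :=
    ⟨fun i => t.equivFin.symm i, by
      ext x; simpa using ⟨fun ⟨y, hy⟩ => hy ▸ (t.equivFin.symm y).2,
        fun hx => ⟨t.equivFin ⟨x, hx⟩, by simp⟩⟩⟩
  refine ⟨ofSystem (I := Fin t.card ⊕ Fin n) (L := Fin m)
    (Sum.elim t' c) (Sum.elim (fun _ _ => 0) fun i => Pi.single i 1), ?_, ?_⟩
  · rw [realize_ofSystem]
    refine ⟨fun j => π (Pi.single j 1), ?_⟩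
    rintro (i | i)
    · have := hπt (t' i) (ht' ▸ Set.mem_range_self i : t' i ∈ (t : Set _))
      simp [← hπsum, this]
    · simp [← hπsum, hπ, Pi.single_apply, ite_smul]
  · intro N _ _ b hb
    rw [realize_ofSystem] at hb
    obtain ⟨y, hy⟩ := hb
    let g : (Fin m → R) →ₗ[R] N := Fintype.linearCombination R y
    have hg : Submodule.span R (t : Set (Fin m → R)) ≤ LinearMap.ker g := by
      rw [Submodule.span_le, ← ht']
      rintro _ ⟨i, rfl⟩
      simpa [g, Fintype.linearCombination_apply] using hy (Sum.inl i)
    refine ⟨Submodule.liftQ _ g hg ∘ₗ e.toLinearMap, fun i => ?_⟩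
    have := hy (Sum.inr i)
    simp only [LinearMap.comp_apply, LinearEquiv.coe_coe, ← hc]
    simpa [g, Fintype.linearCombination_apply, Pi.single_apply, ite_smul] using this

theorem Generates.isFreeRealization [Module.FinitePresentation R M] {φ : PPFormula R n}
    {a : Fin n → M} (h : φ.Generates a) : φ.IsFreeRealization a := by
  obtain ⟨χ, hχ⟩ := exists_isFreeRealization (R := R) a
  exact ⟨h.1, fun N _ _ b hb => hχ.2 N b (h.2 χ hχ.1 N b hb)⟩

end Free

end PPFormula

/-! ### Elimination of quantifiers down to pp formulas -/

namespace PPFormula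

variable {R : Type u} [Ring R] {n : ℕ}

/-- The subgroup of those `y` for which `(0, …, 0, y)` satisfies `φ`. The sets `{y | φ(x, y)}`
are empty or cosets of it. -/
def fiber (φ : PPFormula R (n + 1)) (M : Type u) [AddCommGroup M] [Module R M] :
    AddSubgroup M where
  carrier := {y | φ.Realize (Fin.snoc (α := fun _ => M) 0 y)}
  zero_mem' := by
    have h : Fin.snoc (α := fun _ => M) (0 : Fin n → M) 0 = 0 := by
      ext i; refine Fin.lastCases ?_ (fun i => ?_) i <;> simp
    simpa only [Set.mem_ofPred_eq, h] using φ.realize_zero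
  add_mem' {a b} ha hb := by
    have h : Fin.snoc (α := fun _ => M) (0 : Fin n → M) (a + b) =
        Fin.snoc (α := fun _ => M) 0 a + Fin.snoc (α := fun _ => M) 0 b := by
      ext i; refine Fin.lastCases ?_ (fun i => ?_) i <;> simp
    simpa only [Set.mem_ofPred_eq, h] using Realize.add ha hb
  neg_mem' {a} ha := by
    have h : Fin.snoc (α := fun _ => M) (0 : Fin n → M) (-a) =
        -Fin.snoc (α := fun _ => M) 0 a := by
      ext i; refine Fin.lastCases ?_ (fun i => ?_) i <;> simp
    simpa only [Set.mem_ofPred_eq, h] using Realize.neg ha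

theorem mem_fiber {φ : PPFormula R (n + 1)} {M : Type u} [AddCommGroup M] [Module R M] {y : M} :
    y ∈ φ.fiber M ↔ φ.Realize (Fin.snoc (α := fun _ => M) 0 y) :=
  Iff.rfl

theorem snoc_sub_snoc {M : Type u} [AddCommGroup M] (x : Fin n → M) (y z : M) :
    Fin.snoc (α := fun _ => M) x y - Fin.snoc (α := fun _ => M) x z =
      Fin.snoc (α := fun _ => M) 0 (y - z) := by
  ext i; refine Fin.lastCases ?_ (fun i => ?_) i <;> simp

theorem Realize.realize_snoc_iff {φ : PPFormula R (n + 1)} {M : Type u} [AddCommGroup M]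
    [Module R M] {x : Fin n → M} {z : M} (hz : φ.Realize (Fin.snoc (α := fun _ => M) x z))
    (y : M) : φ.Realize (Fin.snoc (α := fun _ => M) x y) ↔ y - z ∈ φ.fiber M := by
  rw [mem_fiber, ← snoc_sub_snoc x y z]
  exact ⟨fun h => h.sub hz, fun h => by simpa using h.add hz⟩

theorem comp_snoc_zero {M N : Type u} [AddCommGroup M] [Module R M] [AddCommGroup N]
    [Module R N] (f : M →ₗ[R] N) (y : M) : f ∘ Fin.snoc (α := fun _ => M) (0 : Fin n → M) y =
      Fin.snoc (α := fun _ => N) 0 (f y) := by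
  ext i; refine Fin.lastCases ?_ (fun i => ?_) i <;> simp

theorem map_mem_fiber {φ : PPFormula R (n + 1)} {M N : Type u} [AddCommGroup M] [Module R M]
    [AddCommGroup N] [Module R N] (f : M →ₗ[R] N) {y : M} (hy : y ∈ φ.fiber M) :
    f y ∈ φ.fiber N := by
  rw [mem_fiber, ← comp_snoc_zero]
  exact Realize.map hy f

/-- The conjunction of the formulas `φ i` with `i ∈ S`. -/
noncomputable def conjOn {I : Type} [DecidableEq I] (φ : I → PPFormula R n) (S : Finset I) :
    PPFormula R n :=
  conj fun i : S => φ i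

theorem realize_conjOn {I : Type} [DecidableEq I] (φ : I → PPFormula R n) (S : Finset I)
    {M : Type u} [AddCommGroup M] [Module R M] (x : Fin n → M) :
    (conjOn φ S).Realize x ↔ ∀ i ∈ S, (φ i).Realize x := by
  rw [conjOn, realize_conj, Subtype.forall]

/-- The indices of the fibers of pp formulas in `M` are all `1` or infinite, and the relation `Z`
tells which of them are `1`. -/
def IndicesGovernedBy (Z : ∀ n, PPFormula R (n + 1) → PPFormula R (n + 1) → Prop) (M : Type u)
    [AddCommGroup M] [Module R M] : Prop :=
  ∀ (n : ℕ) (φ ψ : PPFormula R (n + 1)),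
    (Z n φ ψ → φ.fiber M ≤ ψ.fiber M) ∧ (¬ Z n φ ψ → (ψ.fiber M).relIndex (φ.fiber M) = 0)

variable {Z : ∀ n, PPFormula R (n + 1) → PPFormula R (n + 1) → Prop} {M : Type u}
  [AddCommGroup M] [Module R M]

open scoped Pointwise in
/-- The set defined by a pp formula is covered by the sets defined by finitely many others only
if it meets one of those whose fiber is larger. By B. H. Neumann's lemma, cosets of infinite
index contribute nothing to a finite cover. -/
theorem IndicesGovernedBy.exists_of_cover (hM : IndicesGovernedBy Z M) {I : Type} [Finite I]
    (χ : PPFormula R (n + 1)) (φ : I → PPFormula R (n + 1)) (x : Fin n → M) {z : M}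
    (hz : χ.Realize (Fin.snoc (α := fun _ => M) x z))
    (hcover : ∀ y, χ.Realize (Fin.snoc (α := fun _ => M) x y) →
      ∃ i, (φ i).Realize (Fin.snoc (α := fun _ => M) x y)) :
    ∃ i, Z n χ (φ i) ∧ ∃ y, χ.Realize (Fin.snoc (α := fun _ => M) x y) ∧
      (φ i).Realize (Fin.snoc (α := fun _ => M) x y) := by
  classical
  have := Fintype.ofFinite I
  let H := χ.fiber M
  let s : Finset I := {i | ∃ y, χ.Realize (Fin.snoc (α := fun _ => M) x y) ∧
    (φ i).Realize (Fin.snoc (α := fun _ => M) x y)}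
  -- `g i` is a representative, shifted into the group `H`, of the coset cut out by `φ i`.
  have hg : ∀ i, ∃ g : H, i ∈ s → (φ i).Realize (Fin.snoc (α := fun _ => M) x (z + g)) := by
    intro i
    by_cases hi : i ∈ s
    · obtain ⟨y, hy, hy'⟩ := (Finset.mem_filter.1 hi).2
      exact ⟨⟨y - z, (hz.realize_snoc_iff y).1 hy⟩, fun _ => by simpa using hy'⟩
    · exact ⟨0, fun h => absurd h hi⟩
  choose g hg using hg
  have hcov : ⋃ i ∈ s, g i +ᵥ (((φ i).fiber M).addSubgroupOf H : Set H) = Set.univ := by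
    refine Set.eq_univ_of_forall fun h => ?_
    have hy : χ.Realize (Fin.snoc (α := fun _ => M) x (z + h)) :=
      (hz.realize_snoc_iff _).2 (by simp [H])
    obtain ⟨i, hi⟩ := hcover _ hy
    have his : i ∈ s := Finset.mem_filter.2 ⟨Finset.mem_univ _, _, hy, hi⟩
    refine Set.mem_iUnion₂.2 ⟨i, his, ?_⟩
    rw [mem_leftAddCoset_iff, SetLike.mem_coe, AddSubgroup.mem_addSubgroupOf]
    have := ((hg i his).realize_snoc_iff _).1 hi
    simpa [add_sub_add_left_eq_sub, sub_eq_neg_add] using this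
  obtain ⟨i, his, hi⟩ := AddSubgroup.exists_finiteIndex_of_leftCoset_cover hcov
  refine ⟨i, ?_, (Finset.mem_filter.1 his).2⟩
  by_contra hZ
  exact hi.index_ne_zero ((hM n χ (φ i)).2 hZ)

/-- Which of finitely many pp formulas hold at `(x, y)` can be prescribed by a choice of `y` under
a condition that depends only on which pp formulas hold at `x`. -/
theorem IndicesGovernedBy.exists_forall_iff_mem (hM : IndicesGovernedBy Z M) {I : Type}
    [Finite I] [DecidableEq I] (φ : I → PPFormula R (n + 1)) (x : Fin n → M) (S : Finset I) :
    (∃ y, ∀ i, (φ i).Realize (Fin.snoc (α := fun _ => M) x y) ↔ i ∈ S) ↔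
      (conjOn φ S).exLast.Realize x ∧ ∀ j ∉ S, Z n (conjOn φ S) (φ j) →
        ¬ (conjOn φ (insert j S)).exLast.Realize x := by
  simp only [realize_exLast, realize_conjOn]
  constructor
  · rintro ⟨y, hy⟩
    have hyS : (conjOn φ S).Realize (Fin.snoc (α := fun _ => M) x y) :=
      (realize_conjOn ..).2 fun i hi => (hy i).2 hi
    refine ⟨⟨y, fun i hi => (hy i).2 hi⟩, fun j hj hZ ⟨z, hz⟩ => hj ((hy j).1 ?_)⟩
    have hzS : (conjOn φ S).Realize (Fin.snoc (α := fun _ => M) x z) :=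
      (realize_conjOn ..).2 fun i hi => hz i (Finset.mem_insert_of_mem hi)
    exact ((hz j (Finset.mem_insert_self j S)).realize_snoc_iff y).2
      ((hM n _ _).1 hZ ((hzS.realize_snoc_iff y).1 hyS))
  · rintro ⟨⟨z, hz⟩, h⟩
    by_contra hcon
    push Not at hcon
    obtain ⟨⟨j, hj⟩, hZ, y, hy, hy'⟩ :=
      hM.exists_of_cover (conjOn φ S) (fun j : {j // j ∉ S} => φ j) x
        ((realize_conjOn ..).2 hz) fun y hy => by
          rw [realize_conjOn] at hy
          obtain ⟨i, hi⟩ := hcon y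
          have hi' : i ∉ S := fun h => hi.elim (fun h' => h'.2 h) fun h' => h'.1 (hy i h)
          exact ⟨⟨i, hi'⟩, (hi.resolve_right fun h' => hi' h'.2).1⟩
    rw [realize_conjOn] at hy
    exact h j hj hZ ⟨y, by simpa using ⟨hy', hy⟩⟩

theorem exists_term_realize_eq_sum (t : (moduleLanguage R).Term (Empty ⊕ Fin n)) :
    ∃ c : Fin n → R, ∀ (M : Type u) [AddCommGroup M] [Module R M] (v : Empty → M)
      (x : Fin n → M), t.realize (Sum.elim v x) = ∑ k, c k • x k := by
  induction t with
  | var a =>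
    obtain a | k := a
    · exact a.elim
    · exact ⟨Pi.single k 1, fun M _ _ v x => by simp [Pi.single_apply, ite_smul]⟩
  | @func l f ts ih =>
    choose c hc using ih
    cases f with
    | zero => exact ⟨0, fun M _ _ v x => (by simp : (0 : M) = _)⟩
    | smul r =>
      refine ⟨r • c 0, fun M _ _ v x => ?_⟩
      refine (congrArg (r • ·) (hc 0 M v x)).trans ?_
      simp [Finset.smul_sum, mul_smul]
    | add =>
      refine ⟨c 0 + c 1, fun M _ _ v x => ?_⟩
      refine (congrArg₂ (· + ·) (hc 0 M v x) (hc 1 M v x)).trans ?_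
      simp [add_smul, Finset.sum_add_distrib]

/-- In modules with indices governed by `Z`, the truth of a formula depends only on which of
finitely many pp formulas hold. -/
theorem exists_pp_normalForm (Z : ∀ n, PPFormula R (n + 1) → PPFormula R (n + 1) → Prop)
    (θ : (moduleLanguage R).BoundedFormula Empty n) :
    ∃ (I : Type) (_ : Finite I) (φ : I → PPFormula R n) (P : Set I → Prop),
      ∀ (M : Type u) [AddCommGroup M] [Module R M], IndicesGovernedBy Z M →
        ∀ (v : Empty → M) (x : Fin n → M), θ.Realize v x ↔ P {i | (φ i).Realize x} := by
  classical
  induction θ with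
  | falsum =>
    exact ⟨Empty, inferInstance, Empty.elim, fun _ => False, fun M _ _ _ v x => Iff.rfl⟩
  | equal t₁ t₂ =>
    obtain ⟨c₁, h₁⟩ := exists_term_realize_eq_sum t₁
    obtain ⟨c₂, h₂⟩ := exists_term_realize_eq_sum t₂
    refine ⟨Unit, inferInstance, fun _ => linear (c₁ - c₂), fun Q => () ∈ Q,
      fun M _ _ _ v x => ?_⟩
    refine Iff.trans ?_ (realize_linear (c₁ - c₂) x).symm
    simp only [Pi.sub_apply, sub_smul, Finset.sum_sub_distrib, sub_eq_zero, ← h₁ M v, ← h₂ M v]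
    rfl
  | rel r => exact Empty.elim r
  | imp θ₁ θ₂ ih₁ ih₂ =>
    obtain ⟨I₁, _, φ₁, P₁, h₁⟩ := ih₁
    obtain ⟨I₂, _, φ₂, P₂, h₂⟩ := ih₂
    refine ⟨I₁ ⊕ I₂, inferInstance, Sum.elim φ₁ φ₂,
      fun Q => P₁ (Sum.inl ⁻¹' Q) → P₂ (Sum.inr ⁻¹' Q), fun M _ _ hM v x => ?_⟩
    rw [FirstOrder.Language.BoundedFormula.realize_imp, h₁ M hM, h₂ M hM]
    rfl
  | @all n θ ih =>
    obtain ⟨I, _, φ, P, h⟩ := ih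
    -- Quantify over the sets `S` of formulas that hold at `(x, y)` instead of over `y`.
    refine ⟨Finset I, inferInstance, fun S => (conjOn φ S).exLast,
      fun Q => ∀ S : Finset I, (S ∈ Q ∧ ∀ j ∉ S, Z n (conjOn φ S) (φ j) → insert j S ∉ Q) →
        P S, fun M _ _ hM v x => ?_⟩
    have := Fintype.ofFinite I
    rw [FirstOrder.Language.BoundedFormula.realize_all]
    simp only [h M hM, Set.mem_ofPred_eq, ← hM.exists_forall_iff_mem]
    constructor
    · rintro H S ⟨y, hy⟩
      have : {i | (φ i).Realize (Fin.snoc (α := fun _ => M) x y)} = S := Set.ext fun i => hy i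
      exact this ▸ H y
    · intro H y
      have := H {i | (φ i).Realize (Fin.snoc (α := fun _ => M) x y)} ⟨y, fun i => by simp⟩
      simpa using this

/-- Modules whose fiber indices are governed by the same relation satisfy the same sentences:
a pp formula without free variables holds everywhere. -/
theorem IndicesGovernedBy.completeTheory_model {N : Type u} [AddCommGroup N] [Module R N]
    (hM : IndicesGovernedBy Z M) (hN : IndicesGovernedBy Z N) :
    N ⊨ (moduleLanguage R).completeTheory M := by
  refine ⟨fun θ hθ => ?_⟩
  obtain ⟨I, _, φ, P, h⟩ := exists_pp_normalForm Z θ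
  have key : ∀ (K : Type u) [AddCommGroup K] [Module R K] (x : Fin 0 → K),
      {i | (φ i).Realize x} = Set.univ := fun K _ _ x =>
    Set.eq_univ_of_forall fun i => by
      rw [Subsingleton.elim x 0]
      exact (φ i).realize_zero
  have h₁ := (h M hM default default).1 (FirstOrder.Language.mem_completeTheory.1 hθ)
  rw [key] at h₁
  exact (h N hN default default).2 (by rwa [key])

end PPFormula

/-! ### Finite parts of direct sums -/

section DirectSum

variable {R : Type u} [Ring R] {J : Type u} {X : J → Type u}
  [∀ j, AddCommGroup (X j)] [∀ j, Module R (X j)]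

variable (R X) in
/-- The submodule of the elements of a direct sum supported on `s`. -/
def DirectSum.supportedOn (s : Finset J) : Submodule R (⨁ j, X j) where
  carrier := {x | ∀ j ∉ s, x j = 0}
  zero_mem' _ _ := rfl
  add_mem' {x y} hx hy j hj := by
    rw [DirectSum.add_apply, hx j hj, hy j hj, add_zero]
  smul_mem' r x hx j hj := by
    rw [DirectSum.smul_apply, hx j hj, smul_zero]

theorem DirectSum.supportedOn_mono {s t : Finset J} (h : s ≤ t) :
    DirectSum.supportedOn R X s ≤ DirectSum.supportedOn R X t :=
  fun _ hx j hj => hx j fun h' => hj (h h')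

variable [DecidableEq J]

variable (R X) in
/-- The projection of a direct sum to a finite product of summands. -/
def DirectSum.toFinsetPi (s : Finset J) : (⨁ j, X j) →ₗ[R] ∀ j : s, X j :=
  LinearMap.pi fun j => DirectSum.component R J X j

variable (R X) in
/-- The inclusion of a finite product of summands in a direct sum. -/
def DirectSum.ofFinsetPi (s : Finset J) : (∀ j : s, X j) →ₗ[R] ⨁ j, X j :=
  ∑ j : s, DirectSum.lof R J X j ∘ₗ LinearMap.proj j

theorem DirectSum.ofFinsetPi_apply (s : Finset J) (y : ∀ j : s, X j) (j : J) :
    DirectSum.ofFinsetPi R X s y j = if h : j ∈ s then y ⟨j, h⟩ else 0 := by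
  rw [ofFinsetPi, LinearMap.sum_apply, DFinsupp.finsetSum_apply]
  split_ifs with h
  · rw [Finset.sum_eq_single ⟨j, h⟩]
    · exact DirectSum.lof_apply R j _
    · intro k _ hk
      exact DFinsupp.single_eq_of_ne fun h' => hk (Subtype.ext h'.symm)
    · simp
  · refine Finset.sum_eq_zero fun k _ => ?_
    exact DFinsupp.single_eq_of_ne fun h' => h (h' ▸ k.2)

theorem DirectSum.ofFinsetPi_toFinsetPi {s : Finset J} {x : ⨁ j, X j}
    (hx : ∀ j ∉ s, x j = 0) : DirectSum.ofFinsetPi R X s (DirectSum.toFinsetPi R X s x) = x := by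
  refine DFinsupp.ext fun j => ?_
  refine (DirectSum.ofFinsetPi_apply s _ j).trans ?_
  split_ifs with h
  · rfl
  · exact (hx j h).symm

theorem DirectSum.exists_finset_forall_notMem_eq_zero {K : Type} [Finite K] (x : K → ⨁ j, X j) :
    ∃ s : Finset J, ∀ k, ∀ j ∉ s, x k j = 0 := by
  classical
  have := Fintype.ofFinite K
  refine ⟨Finset.univ.biUnion fun k => DFinsupp.support (x k), fun k j hj => ?_⟩
  by_contra h
  exact hj (Finset.mem_biUnion.2 ⟨k, Finset.mem_univ _, DFinsupp.mem_support_iff.2 h⟩)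

end DirectSum

/-! ### The class `add A` -/

section AddClosure

variable {R : Type u} [Ring R] {ι : Type u} {A : ι → Type u} [∀ i, AddCommGroup (A i)]
  [∀ i, Module R (A i)]

theorem addClosure_iff_exists_pi {M : ModuleCat.{u} R} :
    addClosure R A M ↔ ∃ (k : ℕ) (s : Fin k → ι), IsDirectSummand R M (∀ j, A (s j)) := by
  refine exists_congr fun k => exists_congr fun s => ⟨?_, ?_⟩
  · rintro ⟨i, p, h⟩
    let e := DirectSum.linearEquivFunOnFintype R (Fin k) fun j => A (s j)
    exact ⟨e ∘ₗ i, p ∘ₗ e.symm.toLinearMap, by ext x; simpa using LinearMap.congr_fun h x⟩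
  · rintro ⟨i, p, h⟩
    let e := DirectSum.linearEquivFunOnFintype R (Fin k) fun j => A (s j)
    exact ⟨e.symm.toLinearMap ∘ₗ i, p ∘ₗ e, by ext x; simpa using LinearMap.congr_fun h x⟩

theorem addClosure_of_pi {M : ModuleCat.{u} R} {K : Type*} [Finite K] (s : K → ι)
    (i : M →ₗ[R] ∀ j, A (s j)) (p : (∀ j, A (s j)) →ₗ[R] M) (h : p ∘ₗ i = LinearMap.id) :
    addClosure R A M := by
  have := Fintype.ofFinite K
  let e := LinearEquiv.piCongrLeft R (fun j => A (s j)) (Fintype.equivFin K).symm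
  exact addClosure_iff_exists_pi.2 ⟨Fintype.card K, fun j => s ((Fintype.equivFin K).symm j),
    e.symm.toLinearMap ∘ₗ i, p ∘ₗ e.toLinearMap, by
      ext x; simpa using LinearMap.congr_fun h x⟩

theorem addClosure.prod {M N : ModuleCat.{u} R} (hM : addClosure R A M)
    (hN : addClosure R A N) : addClosure R A (ModuleCat.of R (M × N)) := by
  obtain ⟨k, s, i, p, h⟩ := addClosure_iff_exists_pi.1 hM
  obtain ⟨l, t, j, q, h'⟩ := addClosure_iff_exists_pi.1 hN
  let e := LinearEquiv.sumPiEquivProdPi R (Fin k) (Fin l) fun v => A (Sum.elim s t v)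
  let f : (M × N) →ₗ[R] (∀ v, A (s v)) × (∀ v, A (t v)) := i.prodMap j
  let g : ((∀ v, A (s v)) × (∀ v, A (t v))) →ₗ[R] M × N := p.prodMap q
  have hgf : ∀ x, g (f x) = x := fun x =>
    Prod.ext (LinearMap.congr_fun h x.1) (LinearMap.congr_fun h' x.2)
  exact addClosure_of_pi (M := ModuleCat.of R (M × N)) (Sum.elim s t)
    (e.symm.toLinearMap ∘ₗ f) (g ∘ₗ e.toLinearMap)
    (LinearMap.ext fun x => (congrArg g (e.apply_symm_apply _)).trans (hgf x))

theorem IsDirectSummand.finitePresentation {M N : Type u} [AddCommGroup M] [Module R M]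
    [AddCommGroup N] [Module R N] [Module.FinitePresentation R N] (h : IsDirectSummand R M N) :
    Module.FinitePresentation R M := by
  obtain ⟨i, p, h⟩ := h
  have hpi : ∀ x, p (i x) = x := LinearMap.congr_fun h
  refine Module.finitePresentation_of_surjective p (fun x => ⟨i x, hpi x⟩) ?_
  -- The kernel of `p` is the range of the complementary idempotent.
  have hker : LinearMap.ker p = LinearMap.range (LinearMap.id - i ∘ₗ p) := by
    ext x
    constructor
    · intro hx
      exact ⟨x, by simp [LinearMap.mem_ker.1 hx]⟩
    · rintro ⟨y, rfl⟩
      simp [hpi]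
  rw [hker, LinearMap.range_eq_map]
  exact (Module.Finite.fg_top (R := R) (M := N)).map _

theorem addClosure.finitePresentation [∀ i, Module.FinitePresentation R (A i)]
    {M : ModuleCat.{u} R} (hM : addClosure R A M) : Module.FinitePresentation R M := by
  obtain ⟨k, s, h⟩ := addClosure_iff_exists_pi.1 hM
  exact h.finitePresentation

end AddClosure

/-! ### Indices of fibers in `F_A ⊕ B_Φ` -/

namespace PPFormula

variable {R : Type u} [Ring R] {n : ℕ} {φ ψ : PPFormula R (n + 1)}

theorem fiber_le_of_isDirectSummand {M N : Type u} [AddCommGroup M] [Module R M]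
    [AddCommGroup N] [Module R N] (h : IsDirectSummand R M N)
    (hN : φ.fiber N ≤ ψ.fiber N) : φ.fiber M ≤ ψ.fiber M := by
  obtain ⟨i, p, h⟩ := h
  intro y hy
  have := map_mem_fiber p (hN (map_mem_fiber i hy))
  rwa [← LinearMap.comp_apply, h] at this

theorem fiber_le_directSum {J : Type u} {X : J → Type u} [∀ j, AddCommGroup (X j)]
    [∀ j, Module R (X j)] (h : ∀ j, φ.fiber (X j) ≤ ψ.fiber (X j)) :
    φ.fiber (⨁ j, X j) ≤ ψ.fiber (⨁ j, X j) := by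
  classical
  intro y hy
  rw [← DirectSum.sum_support_of y]
  exact sum_mem fun j _ => map_mem_fiber (DirectSum.lof R J X j)
    (h j (map_mem_fiber (DirectSum.component R J X j) hy))

theorem fiber_le_finsupp {M : Type u} [AddCommGroup M] [Module R M]
    (h : φ.fiber M ≤ ψ.fiber M) : φ.fiber (ℕ →₀ M) ≤ ψ.fiber (ℕ →₀ M) := by
  intro y hy
  rw [← Finsupp.sum_single y]
  exact sum_mem fun k _ => map_mem_fiber (Finsupp.lsingle (R := R) k)
    (h (map_mem_fiber (Finsupp.lapply (R := R) k) hy))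

theorem fiber_le_pi {K : Type} [Finite K] {X : K → Type u} [∀ j, AddCommGroup (X j)]
    [∀ j, Module R (X j)] (h : ∀ j, φ.fiber (X j) ≤ ψ.fiber (X j)) :
    φ.fiber (∀ j, X j) ≤ ψ.fiber (∀ j, X j) := by
  classical
  have := Fintype.ofFinite K
  intro y hy
  rw [← Finset.univ_sum_single y]
  exact sum_mem fun j _ => map_mem_fiber (LinearMap.single R X j)
    (h j (map_mem_fiber (LinearMap.proj j) hy))

theorem fiber_le_directLimit {J : Type} [Preorder J] [Nonempty J]
    [IsDirectedOrder J] [DecidableEq J] {G : J → Type u} [∀ j, AddCommGroup (G j)]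
    [∀ j, Module R (G j)] {f : ∀ i j, i ≤ j → G i →ₗ[R] G j}
    [DirectedSystem G fun i j h => f i j h] (h : ∀ j, φ.fiber (G j) ≤ ψ.fiber (G j)) :
    φ.fiber (Module.DirectLimit G f) ≤ ψ.fiber (Module.DirectLimit G f) := by
  intro y hy
  obtain ⟨j, z, rfl⟩ := Module.DirectLimit.exists_of y
  rw [mem_fiber, ← comp_snoc_zero] at hy
  obtain ⟨k, hjk, hk⟩ := exists_realize_of_directLimit hy
  rw [comp_snoc_zero] at hk
  rw [← Module.DirectLimit.of_f (hij := hjk)]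
  exact map_mem_fiber _ (h k hk)

theorem fiber_le_prod {M N : Type u} [AddCommGroup M] [Module R M]
    [AddCommGroup N] [Module R N] (hM : φ.fiber M ≤ ψ.fiber M) (hN : φ.fiber N ≤ ψ.fiber N) :
    φ.fiber (M × N) ≤ ψ.fiber (M × N) := by
  intro y hy
  have h₁ := map_mem_fiber (LinearMap.inl R M N) (hM (map_mem_fiber (LinearMap.fst R M N) hy))
  have h₂ := map_mem_fiber (LinearMap.inr R M N) (hN (map_mem_fiber (LinearMap.snd R M N) hy))
  simpa using add_mem h₁ h₂

end PPFormula

section Governed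

variable {R : Type u} [Ring R] {ι : Type u} {A : ι → Type u} [∀ i, AddCommGroup (A i)]
  [∀ i, Module R (A i)]

namespace PPFormula

/-- Infinitely many independent copies of an element `a` separating `φ` from `ψ` lie in distinct
cosets, as the difference of two of them projects to `a`. -/
theorem relIndex_fiber_eq_zero {n : ℕ} {φ ψ : PPFormula R (n + 1)} {K M : Type u}
    [AddCommGroup K] [Module R K] [AddCommGroup M] [Module R M] (e : ℕ → K →ₗ[R] M)
    (p : ℕ → M →ₗ[R] K) (h : ∀ k x, p k (e k x) = x) (h' : ∀ k l x, k ≠ l → p k (e l x) = 0)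
    (hK : ¬ φ.fiber K ≤ ψ.fiber K) : (ψ.fiber M).relIndex (φ.fiber M) = 0 := by
  obtain ⟨a, ha, ha'⟩ := SetLike.not_le_iff_exists.1 hK
  by_contra hne
  have : Finite (φ.fiber M ⧸ (ψ.fiber M).addSubgroupOf (φ.fiber M)) :=
    (Nat.card_ne_zero.1 hne).2
  let q : ℕ → φ.fiber M ⧸ (ψ.fiber M).addSubgroupOf (φ.fiber M) := fun k =>
    QuotientAddGroup.mk ⟨e k a, map_mem_fiber (e k) ha⟩
  refine not_injective_infinite_finite q fun k l hkl => ?_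
  by_contra hne'
  have hmem := QuotientAddGroup.eq.1 hkl.symm
  rw [AddSubgroup.mem_addSubgroupOf] at hmem
  have := map_mem_fiber (p k) hmem
  simp [h, h' k l a hne'] at this
  exact ha' this

/-- The relation that governs the indices in `F_A` and `F_A ⊕ B_Φ`: the fiber of `φ` is contained in
that of `ψ` in every member of the family `A`. -/
def FiberLE (A : ι → Type u) [∀ i, AddCommGroup (A i)] [∀ i, Module R (A i)] (n : ℕ)
    (φ ψ : PPFormula R (n + 1)) : Prop :=
  ∀ i, φ.fiber (A i) ≤ ψ.fiber (A i)

theorem FiberLE.of_addClosure {n : ℕ} {φ ψ : PPFormula R (n + 1)} (h : FiberLE A n φ ψ)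
    {M : ModuleCat.{u} R} (hM : addClosure R A M) : φ.fiber M ≤ ψ.fiber M := by
  obtain ⟨k, s, hM⟩ := addClosure_iff_exists_pi.1 hM
  exact fiber_le_of_isDirectSummand hM (fiber_le_pi fun j => h (s j))

theorem FiberLE.pureFree {n : ℕ} {φ ψ : PPFormula R (n + 1)} (h : FiberLE A n φ ψ) :
    φ.fiber (PureFree A) ≤ ψ.fiber (PureFree A) :=
  fiber_le_directSum fun i => fiber_le_finsupp (h i)

theorem relIndex_fiber_eq_zero_of_not_fiberLE {n : ℕ} {φ ψ : PPFormula R (n + 1)}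
    (h : ¬ FiberLE A n φ ψ) {M : Type u} [AddCommGroup M] [Module R M]
    (hM : IsDirectSummand R (PureFree A) M) : (ψ.fiber M).relIndex (φ.fiber M) = 0 := by
  classical
  obtain ⟨e, p, hpe⟩ := hM
  have hpe' : ∀ x, p (e x) = x := LinearMap.congr_fun hpe
  obtain ⟨i, hi⟩ := not_forall.1 h
  refine relIndex_fiber_eq_zero (K := A i)
    (fun k => e ∘ₗ DirectSum.lof R ι (fun i => ℕ →₀ A i) i ∘ₗ Finsupp.lsingle k)
    (fun k => Finsupp.lapply k ∘ₗ DirectSum.component R ι (fun i => ℕ →₀ A i) i ∘ₗ p)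
    (fun k x => ?_) (fun k l x hkl => ?_) hi
  · simp [hpe']
  · simp [hpe', hkl]

theorem indicesGovernedBy_pureFree :
    IndicesGovernedBy (R := R) (fun n => FiberLE A n) (PureFree A) :=
  fun _ _ _ => ⟨fun h => h.pureFree, fun h =>
    relIndex_fiber_eq_zero_of_not_fiberLE h ⟨LinearMap.id, LinearMap.id, rfl⟩⟩

/-- The indices in `F_A ⊕ N` are those in `F_A` if the inclusions of fibers that hold throughout
`A` also hold in `N`. -/
theorem indicesGovernedBy_pureFree_prod {N : Type u} [AddCommGroup N] [Module R N]
    (hN : ∀ (n : ℕ) (φ ψ : PPFormula R (n + 1)), FiberLE A n φ ψ → φ.fiber N ≤ ψ.fiber N) :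
    IndicesGovernedBy (R := R) (fun n => FiberLE A n) (PureFree A × N) :=
  fun n φ ψ => ⟨fun h => fiber_le_prod h.pureFree (hN n φ ψ h), fun h =>
    relIndex_fiber_eq_zero_of_not_fiberLE h
      ⟨LinearMap.inl R _ N, LinearMap.fst R _ N, LinearMap.fst_comp_inl ..⟩⟩

end PPFormula

end Governed

/-! ### Bass modules -/

section Bass

variable {R : Type u} [Ring R] {ι : Type u} {A : ι → Type u} [∀ i, AddCommGroup (A i)]
  [∀ i, Module R (A i)] {n : ℕ} {Φ : ℕ → PPFormula R n}

theorem nonempty_bassSystem [∀ i, Module.FinitePresentation R (A i)] (hdesc : Antitone Φ)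
    (hΓ : ∀ k, Φ k ∈ PPFormula.Gamma (addClosure R A) n) :
    Nonempty (BassSystem (addClosure R A) Φ) := by
  choose M a hM ha using hΓ
  have hfree : ∀ k, (Φ k).IsFreeRealization (a k) := fun k =>
    have := (hM k).finitePresentation
    (ha k).isFreeRealization
  choose g hg using fun k =>
    (hfree k).2 (M (k + 1)) (a (k + 1)) (hdesc (Nat.le_succ k) _ _ (hfree (k + 1)).1)
  exact ⟨⟨M, a, hM, hfree, g, hg⟩⟩

namespace BassSystem

variable (S : BassSystem (addClosure R A) Φ)

theorem pureFree_prod_bassModule_model :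
    (PureFree A × S.bassModule) ⊨ pureFreeTheory R A :=
  (PPFormula.indicesGovernedBy_pureFree (R := R)).completeTheory_model
    (PPFormula.indicesGovernedBy_pureFree_prod fun _ _ _ h =>
      PPFormula.fiber_le_directLimit fun k => h.of_addClosure (S.mem k))

theorem trans_pt {i j : ℕ} (h : i ≤ j) : S.trans i j h ∘ S.pt i = S.pt j := by
  induction h with
  | refl => rw [S.trans_self]; rfl
  | @step m hm ih =>
    have hm' : i ≤ m := hm
    rw [S.trans_succ i m hm']
    exact funext fun l => (congrArg (S.map m) (congrFun ih l)).trans (S.map_pt m l)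

/-- The image in the Bass module of the distinguished tuples. -/
noncomputable def limitPt : Fin n → S.bassModule :=
  Module.DirectLimit.of R ℕ (fun k => S.obj k) S.trans 0 ∘ S.pt 0

theorem of_pt (k : ℕ) :
    Module.DirectLimit.of R ℕ (fun k => S.obj k) S.trans k ∘ S.pt k = S.limitPt := by
  rw [limitPt, ← S.trans_pt (Nat.zero_le k)]
  exact funext fun l => Module.DirectLimit.of_f

theorem realize_limitPt_iff {ψ : PPFormula R n} :
    ψ.Realize S.limitPt ↔ ∃ k, Φ k ≤ ψ := by
  constructor
  · intro h
    rw [limitPt] at h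
    obtain ⟨k, hk, h⟩ := PPFormula.exists_realize_of_directLimit h
    rw [S.trans_pt] at h
    exact ⟨k, (S.free k).generates.2 ψ h⟩
  · rintro ⟨k, hk⟩
    rw [← S.of_pt k]
    exact PPFormula.Realize.map (hk _ _ (S.free k).1) _

/-- A generator of the pp type of the limit tuple lies between `Φ k` and all the `Φ m`. -/
theorem not_isMittagLefflerModule (hdesc : Antitone Φ) (hΦ : ¬ PPFormula.Stabilizes Φ)
    (N : Type u) [AddCommGroup N] [Module R N] :
    ¬ IsMittagLefflerModule R (N × S.bassModule) := by
  intro h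
  obtain ⟨φ, hφ, hmin⟩ := h n (LinearMap.inr R N S.bassModule ∘ S.limitPt)
  obtain ⟨k, hk⟩ := S.realize_limitPt_iff.1
    (PPFormula.Realize.map hφ (LinearMap.snd R N S.bassModule))
  exact hΦ ⟨k, fun m hm => ⟨hk.trans (hmin _ (PPFormula.Realize.map
    (S.realize_limitPt_iff.2 ⟨m, le_rfl⟩) _)), hdesc hm⟩⟩

/-- `F_A ⊕ B_Φ` is the direct limit of the sums of a finite partial sum of `F_A` and a member of
the chain defining `B_Φ`. -/
theorem limClosure_pureFree_prod_bassModule :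
    limClosure R (addClosure R A) (ModuleCat.of R (PureFree A × S.bassModule)) := by
  classical
  let X : (Σ _ : ι, ℕ) → Type u := fun q => A q.1
  let G : Finset (Σ _ : ι, ℕ) × ℕ → ModuleCat.{u} R := fun q =>
    ModuleCat.of R (DirectSum.supportedOn R X q.1 × S.obj q.2)
  let f : ∀ i j, i ≤ j → G i →ₗ[R] G j := fun i j h =>
    (Submodule.inclusion (DirectSum.supportedOn_mono h.1)).prodMap (S.trans i.2 j.2 h.2)
  have hsys : DirectedSystem (fun j => G j) (fun i j h => f i j h) :=
    { map_self := fun i (x : DirectSum.supportedOn R X i.1 × S.obj i.2) =>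
        have h : S.trans i.2 i.2 le_rfl x.2 = x.2 :=
          DirectedSystem.map_self' (fun i j h => S.trans i j h) _
        Prod.ext rfl h
      map_map := fun k j i hij hjk (x : DirectSum.supportedOn R X i.1 × S.obj i.2) =>
        have h : S.trans j.2 k.2 hjk.2 (S.trans i.2 j.2 hij.2 x.2) =
            S.trans i.2 k.2 (hij.2.trans hjk.2) x.2 :=
          DirectedSystem.map_map' (fun i j h => S.trans i j h) hij.2 hjk.2 _
        Prod.ext rfl h }
  let c : ∀ j, G j →ₗ[R] (⨁ q, X q) × S.bassModule := fun j =>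
    (Submodule.subtype _).prodMap (Module.DirectLimit.of R ℕ (fun k => S.obj k) S.trans j.2)
  have hc : ∀ i j hij x, c j (f i j hij x) = c i x := fun i j hij x =>
    Prod.ext rfl Module.DirectLimit.of_f
  let g := Module.DirectLimit.lift R _ (fun j => G j) f c hc
  have hg : Function.Bijective g := by
    constructor
    · intro z w hzw
      obtain ⟨j, x, y, rfl, rfl⟩ := Module.DirectLimit.exists_of₂ z w
      have hxy : c j x = c j y :=
        (Module.DirectLimit.lift_of ..).symm.trans (hzw.trans (Module.DirectLimit.lift_of ..))
      -- The maps out of the first factors are inclusions, so only the chain has to move on.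
      obtain ⟨k, hk, h⟩ := Module.DirectLimit.exists_eq_of_of_eq (congrArg Prod.snd hxy)
      have hjk : j ≤ (j.1, k) := ⟨le_rfl, hk⟩
      have hf : f j (j.1, k) hjk x = f j (j.1, k) hjk y :=
        Prod.ext (Subtype.ext (congrArg Prod.fst hxy)) h
      exact (Module.DirectLimit.of_f (hij := hjk)).symm.trans
        ((congrArg (Module.DirectLimit.of R _ (fun j => G j) f (j.1, k)) hf).trans
          (Module.DirectLimit.of_f (hij := hjk)))
    · rintro ⟨x, y⟩
      obtain ⟨k, y, rfl⟩ := Module.DirectLimit.exists_of y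
      obtain ⟨s, hs⟩ :=
        DirectSum.exists_finset_forall_notMem_eq_zero (K := Unit) fun _ => x
      refine ⟨Module.DirectLimit.of R _ (fun j => G j) f (s, k) (⟨x, hs ()⟩, y), ?_⟩
      exact Module.DirectLimit.lift_of ..
  let e₁ : PureFree A ≃ₗ[R] ⨁ (i : ι) (_ : ℕ), A i :=
    DFinsupp.mapRange.linearEquiv fun i => finsuppLEquivDirectSum R (A i) ℕ
  let e₂ : (⨁ q, X q) ≃ₗ[R] ⨁ (i : ι) (_ : ℕ), A i :=
    DirectSum.sigmaLcurryEquiv R (δ := fun i (_ : ℕ) => A i)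
  refine ⟨_, inferInstance, inferInstance, inferInstance, inferInstance, G, f, hsys,
    fun j => addClosure.prod (M := ModuleCat.of R (DirectSum.supportedOn R X j.1)) ?_
      (S.mem j.2),
    ⟨((e₁.trans e₂.symm).prodCongr (.refl R _)).trans (LinearEquiv.ofBijective g hg).symm⟩⟩
  refine addClosure_of_pi (fun q : j.1 => q.1.1)
    (DirectSum.toFinsetPi R X j.1 ∘ₗ Submodule.subtype _)
    ((DirectSum.ofFinsetPi R X j.1).codRestrict _ fun y q hq => ?_)
    (LinearMap.ext fun x => Subtype.ext (DirectSum.ofFinsetPi_toFinsetPi x.2))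
  exact (DirectSum.ofFinsetPi_apply j.1 y q).trans (dif_neg hq)

end BassSystem

/-- A tuple in a direct sum of finitely presented modules lies in a finite subsum, where it is a
free realization of some pp formula. -/
theorem IsPureProjective.isMittagLefflerModule {M : Type u} [AddCommGroup M] [Module R M]
    (h : IsPureProjective R M) : IsMittagLefflerModule R M := by
  classical
  intro n a
  obtain ⟨J, X, hX, i, p, hpi⟩ := h
  obtain ⟨s, hs⟩ := DirectSum.exists_finset_forall_notMem_eq_zero fun k => i (a k)
  let r := DirectSum.toFinsetPi R (fun j => X j) s
  obtain ⟨φ, hφ⟩ := PPFormula.exists_isFreeRealization (R := R) fun k => r (i (a k))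
  refine ⟨φ, ?_, fun ψ hψ => hφ.generates.2 ψ (PPFormula.Realize.map hψ (r ∘ₗ i))⟩
  have := PPFormula.Realize.map hφ.1 (p ∘ₗ DirectSum.ofFinsetPi R (fun j => X j) s)
  refine (congrArg φ.Realize (funext fun k => ?_)).mp this
  exact (congrArg p (DirectSum.ofFinsetPi_toFinsetPi (hs k))).trans (LinearMap.congr_fun hpi (a k))

end Bass

theorem mainTheorem6 {R : Type u} [Ring R] {ι : Type u} (A : ι → Type u)
    [∀ i, AddCommGroup (A i)] [∀ i, Module R (A i)] [∀ i, Module.FinitePresentation R (A i)]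
    {n : ℕ} (Φ : ℕ → PPFormula R n) (hdesc : Antitone Φ)
    (hΓ : ∀ k, Φ k ∈ PPFormula.Gamma (addClosure R A) n) :
    Nonempty (BassSystem (addClosure R A) Φ) ∧
    ∀ S : BassSystem (addClosure R A) Φ,
      (PureFree A × S.bassModule) ⊨ pureFreeTheory R A ∧
      (¬ PPFormula.Stabilizes Φ →
        IsCModel R A (PureFree A × S.bassModule) ∧
        ¬ IsMittagLefflerModule R (PureFree A × S.bassModule) ∧
        ¬ IsPureProjective R (PureFree A × S.bassModule)) :=
  ⟨nonempty_bassSystem hdesc hΓ, fun S => ⟨S.pureFree_prod_bassModule_model, fun hΦ =>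
    have hML := S.not_isMittagLefflerModule hdesc hΦ (PureFree A)
    ⟨⟨S.pureFree_prod_bassModule_model, S.limClosure_pureFree_prod_bassModule⟩, hML,
      fun h => hML h.isMittagLefflerModule⟩⟩⟩
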